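/- Let $A$ be an infinite-dimensional separable complex Hilbert space and let $H$ be a Hamiltonian on $A$: a self-adjoint, in general unbounded, operator with discrete spectrum, $H=\sum_{n} E_n\,|n\rangle\langle n|$ for an orthonormal basis $(|n\rangle)_{n\in\mathbb N}$ of eigenvectors, with ground state energy $\min_n E_n=0$. Assume the Gibbs Hypothesis: $Z(\beta):=\operatorname{tr} e^{-\beta H}<\infty$ for every $\beta>0$. A state is a positive operator $\rho$ on $A$ with $\operatorname{tr}\rho=1$; its energy is $\operatorname{tr}\rho H=\sum_n E_n\langle n|\rho|n\rangle\in[0,\infty]$, and its von Neumann entropy is $S(\rho)=-\operatorname{tr}\rho\log\rho\in[0,\infty]$, where $\log$ is taken to an arbitrary fixed base greater than $1$. For every $E>0$ there is a unique $\beta(E)>0$ with $\operatorname{tr} e^{-\beta(E)H}(H-E)=0$. Put $\gamma(E)=e^{-\beta(E)H}/Z(\beta(E))$ for $E>0$, and for $E=0$ let $\gamma(0)=P_0/\operatorname{tr}P_0$, where $P_0$ is the projector onto $\ker H$. For every $E\ge 0$, $\gamma(E)$ is a state of energy at most $E$ and finite entropy, and it has the maximal entropy among all states $\rho$ with $\operatorname{tr}\rho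 H\le E$. The function $E\mapsto S(\gamma(E))$ is strictly increasing and strictly concave on $[0,\infty)$. -/

import Mathlib

open scoped NNReal ENNReal InnerProductSpace

set_option linter.unusedSectionVars false

noncomputable section

namespace GibbsEntropy

variable {A : Type*} [NormedAddCommGroup A] [InnerProductSpace ℂ A] [CompleteSpace A]

/-! ## Trace, states and von Neumann entropy -/

/-- The trace `∑ ⟪e, T e⟫ ∈ [0, ∞]` of a positive bounded operator, computed in one orthonormal
basis of the Hilbert space; `trace_eq` shows that every orthonormal basis gives the same value. -/
def trace (T : A →L[ℂ] A) : ℝ≥0∞ :=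
  ∑' e : (exists_hilbertBasis ℂ A).choose, ENNReal.ofReal (RCLike.re ⟪(e : A), T (e : A)⟫_ℂ)

/-- Parseval's identity in `[0, ∞]`. -/
theorem tsum_norm_inner_sq {ι : Type*} (b : HilbertBasis ι ℂ A) (x : A) :
    ∑' i, ENNReal.ofReal (‖⟪b i, x⟫_ℂ‖ ^ 2) = ENNReal.ofReal (‖x‖ ^ 2) := by
  have h := b.hasSum_inner_mul_inner x x
  have h2 : HasSum (fun i => ‖⟪b i, x⟫_ℂ‖ ^ 2) (‖x‖ ^ 2) := by
    have h3 := Complex.reCLM.hasSum h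
    have e1 : Complex.reCLM ⟪x, x⟫_ℂ = ‖x‖ ^ 2 := by
      rw [inner_self_eq_norm_sq_to_K]; simp [← Complex.ofReal_pow]
    rw [e1] at h3
    refine h3.congr_fun ?_
    intro i
    simp only [Complex.reCLM_apply]
    rw [← inner_conj_symm x (b i), Complex.conj_mul']
    simp [← Complex.ofReal_pow]
  rw [← ENNReal.ofReal_tsum_of_nonneg (fun i => by positivity) h2.summable, h2.tsum_eq]

theorem tsum_inner_eq {ι κ : Type*} (b : HilbertBasis ι ℂ A) (c : HilbertBasis κ ℂ A)
    {T : A →L[ℂ] A} (hT : T.IsPositive) :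
    ∑' i, ENNReal.ofReal (RCLike.re ⟪b i, T (b i)⟫_ℂ) =
      ∑' j, ENNReal.ofReal (RCLike.re ⟪c j, T (c j)⟫_ℂ) := by
  have hT0 : 0 ≤ T := (ContinuousLinearMap.nonneg_iff_isPositive T).2 hT
  set R : A →L[ℂ] A := CFC.sqrt T with hR
  have hRsa : IsSelfAdjoint R := (CFC.sqrt_nonneg T).isSelfAdjoint
  have hRR : R * R = T := CFC.sqrt_mul_sqrt_self T hT0
  have hsym : ∀ x y : A, ⟪R x, y⟫_ℂ = ⟪x, R y⟫_ℂ := fun x y => hRsa.isSymmetric x y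
  have key : ∀ x : A, RCLike.re ⟪x, T x⟫_ℂ = ‖R x‖ ^ 2 := by
    intro x
    rw [← hRR, mul_apply_eq_comp, ← hsym]
    exact inner_self_eq_norm_sq (𝕜 := ℂ) _
  simp_rw [key]
  calc ∑' i, ENNReal.ofReal (‖R (b i)‖ ^ 2)
      = ∑' i, ∑' j, ENNReal.ofReal (‖⟪c j, R (b i)⟫_ℂ‖ ^ 2) := by
        simp_rw [tsum_norm_inner_sq c]
    _ = ∑' j, ∑' i, ENNReal.ofReal (‖⟪c j, R (b i)⟫_ℂ‖ ^ 2) := ENNReal.tsum_comm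
    _ = ∑' j, ∑' i, ENNReal.ofReal (‖⟪b i, R (c j)⟫_ℂ‖ ^ 2) := by
        congr 1; ext j; congr 1; ext i
        rw [← hsym, norm_inner_symm]
    _ = ∑' j, ENNReal.ofReal (‖R (c j)‖ ^ 2) := by
        simp_rw [tsum_norm_inner_sq b]

/-- The trace of a positive operator may be computed in any orthonormal basis. -/
theorem trace_eq {ι : Type*} (b : HilbertBasis ι ℂ A) {T : A →L[ℂ] A} (hT : T.IsPositive) :
    trace T = ∑' i, ENNReal.ofReal (RCLike.re ⟪b i, T (b i)⟫_ℂ) := by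
  obtain ⟨c, hc⟩ := (exists_hilbertBasis ℂ A).choose_spec
  rw [tsum_inner_eq b c hT]
  simp only [trace, hc]

/-- A state (density operator): a positive operator of trace one. -/
def IsState (ρ : A →L[ℂ] A) : Prop := ρ.IsPositive ∧ trace ρ = 1

/-- The von Neumann entropy `S(ρ) = -tr ρ log ρ ∈ [0, ∞]`, with logarithms to base `a > 1`.
The operator `-ρ log ρ`, given by the continuous functional calculus, is positive for every
state `ρ`. -/
def entropy (a : ℝ) (ρ : A →L[ℂ] A) : ℝ≥0∞ :=
  trace (cfc (fun x : ℝ => -(x * Real.logb a x)) ρ)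

/-! ## Hamiltonians -/

variable (A) in
/-- A Hamiltonian on an infinite-dimensional separable Hilbert space: an (in general unbounded)
self-adjoint operator with discrete spectrum, bounded below and with ground state energy `0`.
It is diagonal, `H = ∑ Eₙ |n⟩⟨n|`, in an orthonormal basis of eigenvectors `|n⟩`, `n ∈ ℕ`; the
eigenvalues `Eₙ` may be listed in any order and are repeated according to multiplicity. Finite
multiplicities and the absence of accumulation points follow from the Gibbs Hypothesis. -/
structure Hamiltonian where
  op : A →ₗ.[ℂ] A
  selfAdjoint : IsSelfAdjoint op
  basis : HilbertBasis ℕ ℂ A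
  level : ℕ → ℝ
  basis_mem : ∀ n, basis n ∈ op.domain
  op_basis : ∀ n, op ⟨basis n, basis_mem n⟩ = (level n : ℂ) • basis n
  level_nonneg : ∀ n, 0 ≤ level n
  exists_level_eq_zero : ∃ n, level n = 0

theorem memℓp_mul (f : ℕ → ℝ) (hf : ∀ n, |f n| ≤ 1) (g : lp (fun _ : ℕ => ℂ) 2) :
    Memℓp (fun n => (f n : ℂ) * g n) 2 := by
  refine memℓp_gen ?_
  have hg := (lp.memℓp g).summable (by norm_num)
  refine Summable.of_nonneg_of_le (fun n => by positivity) (fun n => ?_) hg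
  refine Real.rpow_le_rpow (norm_nonneg _) ?_ (by norm_num)
  rw [norm_mul, Complex.norm_real, Real.norm_eq_abs]
  exact mul_le_of_le_one_left (norm_nonneg _) (hf n)

/-- The bounded operator `∑ f(n) |n⟩⟨n|`, for a sequence `f` with values in `[-1, 1]`. -/
def diagonal (b : HilbertBasis ℕ ℂ A) (f : ℕ → ℝ) (hf : ∀ n, |f n| ≤ 1) : A →L[ℂ] A :=
  LinearMap.mkContinuous
    { toFun := fun x => b.repr.symm ⟨fun n => (f n : ℂ) * b.repr x n, memℓp_mul f hf _⟩
      map_add' := fun x y => by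
        rw [← map_add]; congr 1; ext n
        simp only [map_add, lp.coeFn_add, Pi.add_apply, mul_add]
      map_smul' := fun c x => by
        rw [RingHom.id_apply, ← map_smul]; congr 1; ext n; simp [mul_left_comm] }
    1 (fun x => by
      simp only [LinearMap.coe_mk, AddHom.coe_mk, LinearIsometryEquiv.norm_map, one_mul]
      rw [← b.repr.norm_map x]
      refine lp.norm_mono (by norm_num) (fun n => ?_)
      change ‖(f n : ℂ) * b.repr x n‖ ≤ ‖b.repr x n‖
      rw [norm_mul, Complex.norm_real, Real.norm_eq_abs]
      exact mul_le_of_le_one_left (norm_nonneg _) (hf n))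

theorem diagonal_basis (b : HilbertBasis ℕ ℂ A) (f : ℕ → ℝ) (hf : ∀ n, |f n| ≤ 1) (n : ℕ) :
    diagonal b f hf (b n) = (f n : ℂ) • b n := by
  apply b.repr.injective
  ext m
  simp only [diagonal, LinearMap.mkContinuous_apply, LinearMap.coe_mk, AddHom.coe_mk,
    LinearIsometryEquiv.apply_symm_apply, map_smul, lp.coeFn_smul, Pi.smul_apply, smul_eq_mul,
    HilbertBasis.repr_self, lp.single_apply, Pi.single_apply]
  split_ifs with h <;> simp [h]

namespace Hamiltonian

variable (H : Hamiltonian A)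

/-- The operator `e^{-βH}` for `β ≥ 0`. -/
def expNeg (β : ℝ≥0) : A →L[ℂ] A :=
  diagonal H.basis (fun n => Real.exp (-(β * H.level n))) (fun n => by
    rw [abs_of_pos (Real.exp_pos _), Real.exp_le_one_iff, neg_nonpos]
    exact mul_nonneg β.2 (H.level_nonneg n))

open Classical in
/-- The orthogonal projector onto the ground space `ker H`. -/
def groundProjector : A →L[ℂ] A :=
  diagonal H.basis (fun n => if H.level n = 0 then 1 else 0) (fun n => by split_ifs <;> simp)

/-- The partition function `Z(β) = tr e^{-βH}`. -/
def partition (β : ℝ≥0) : ℝ≥0∞ := trace (H.expNeg β)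

/-- The Gibbs Hypothesis: `Z(β) < ∞` for every `β > 0`. -/
def GibbsHypothesis : Prop := ∀ β : ℝ≥0, 0 < β → H.partition β < ∞

/-- The energy `tr ρH = ∑ ⟨n| ρH |n⟩ ∈ [0, ∞]` of a positive operator `ρ`. -/
def energy (ρ : A →L[ℂ] A) : ℝ≥0∞ :=
  ∑' n, ENNReal.ofReal (RCLike.re ⟪H.basis n, ρ (H.op ⟨H.basis n, H.basis_mem n⟩)⟫_ℂ)

/-- `β > 0` solves `tr e^{-βH} (H - E) = 0`, that is, `tr e^{-βH} H = E tr e^{-βH}`. -/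
def IsInverseTemperature (E : ℝ) (β : ℝ≥0) : Prop :=
  0 < β ∧ H.energy (H.expNeg β) = ENNReal.ofReal E * H.partition β

open Classical in
/-- The inverse temperature `β(E)` for `E > 0`. -/
def inverseTemperature (E : ℝ) : ℝ≥0 :=
  if h : ∃ β, H.IsInverseTemperature E β then h.choose else 0

/-- The Gibbs state `γ(E)` of energy `E ≥ 0`: for `E > 0` it is `e^{-β(E)H} / Z(β(E))`, and at the
ground state energy `E = 0`, where `β(E) = ∞`, it is the maximally mixed state of the ground
space. -/
def gibbsState (E : ℝ) : A →L[ℂ] A :=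
  if 0 < E then
    ((H.partition (H.inverseTemperature E)).toReal⁻¹ : ℂ) • H.expNeg (H.inverseTemperature E)
  else ((trace H.groundProjector).toReal⁻¹ : ℂ) • H.groundProjector

end Hamiltonian

end GibbsEntropy

end

namespace GibbsEntropy

/-! ## Boltzmann sums -/

/-! In natural logarithms, for E > 0, S(γ(E)) = β(E)E + log Z(β(E)), which is the strict minimum
over β > 0 of βE + log Z(β): this follows from `e^x ≥ 1 + x` averaged with Boltzmann weights
(`free_energy_lt`). It gives uniqueness of β(E); existence is the intermediate value theorem for ∑
(Eₙ - E) e^{-βEₙ}, positive for small β and negative for large β.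

Maximality is Gibbs' inequality. The tangent bound -x log x ≤ (-log q - 1)x + q passes to operators
by functional calculus. Taken at the n-th eigenvector of H, with q the n-th eigenvalue of γ(E), and
summed over n, it bounds S(ρ) by β tr ρH + log Z (`entropy_le_of_weight`).

Finally, inserting β = β(E') in the minimum at E gives S(γ(E)) < S(γ(E')) + β(E')(E - E') for E ≠ E'
(`gibbsEntropy_lt_of_ne`). The curve thus lies strictly below tangent lines of positive slope, hence
is strictly increasing and strictly concave. The point E = 0 is handled by counting ground levels.
-/

/-- A level sequence `L ≥ 0` all of whose Boltzmann sums `∑ e^{-β L n}`, `β > 0`, converge. -/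
structure GibbsSummable (L : ℕ → ℝ) : Prop where
  nonneg : ∀ n, 0 ≤ L n
  summable_exp : ∀ β : ℝ, 0 < β → Summable fun n => Real.exp (-(β * L n))

namespace GibbsSummable

variable {L : ℕ → ℝ}

/-- Half of the exponent absorbs the factor: `L n ≤ (2/β) e^{β L n / 2}`. -/
theorem summable_mul_exp (hL : GibbsSummable L) {β : ℝ} (hβ : 0 < β) :
    Summable fun n => L n * Real.exp (-(β * L n)) := by
  refine Summable.of_nonneg_of_le (fun n => mul_nonneg (hL.nonneg n) (Real.exp_pos _).le)
    (fun n => ?_) ((hL.summable_exp (β / 2) (by positivity)).mul_left (2 / β))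
  have h1 : β / 2 * L n ≤ Real.exp (β / 2 * L n) :=
    (le_add_of_nonneg_right zero_le_one).trans (Real.add_one_le_exp _)
  have h2 : L n ≤ 2 / β * Real.exp (β / 2 * L n) := by
    rw [div_mul_eq_mul_div, le_div_iff₀ hβ]; linarith
  calc L n * Real.exp (-(β * L n))
      ≤ 2 / β * Real.exp (β / 2 * L n) * Real.exp (-(β * L n)) := by gcongr
    _ = 2 / β * Real.exp (-(β / 2 * L n)) := by
        rw [mul_assoc, ← Real.exp_add]; congr 2; ring

/-- Boltzmann factors at `β = 1` tend to zero, so levels accumulate only at infinity. The infinite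
complement supplies levels above any given energy. -/
theorem finite_le (hL : GibbsSummable L) (M : ℝ) : {n | L n ≤ M}.Finite := by
  have h := (hL.summable_exp 1 one_pos).tendsto_cofinite_zero
  have h1 := h.eventually_lt_const (Real.exp_pos (-M))
  refine (Filter.eventually_cofinite.1 h1).subset (fun n hn => ?_)
  simp only [Set.mem_ofPred_eq, not_lt, Real.exp_le_exp] at hn ⊢
  linarith

theorem one_le_tsum (hL : GibbsSummable L) {k : ℕ} (hk : L k = 0) {β : ℝ} (hβ : 0 < β) :
    1 ≤ ∑' n, Real.exp (-(β * L n)) := by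
  have h := (hL.summable_exp β hβ).le_tsum k (fun n _ => (Real.exp_pos _).le)
  simpa [hk] using h

theorem summable_sub_mul_exp (hL : GibbsSummable L) (E : ℝ) {β : ℝ} (hβ : 0 < β) :
    Summable fun n => (L n - E) * Real.exp (-(β * L n)) := by
  simp_rw [sub_mul]
  exact (hL.summable_mul_exp hβ).sub ((hL.summable_exp β hβ).mul_left E)

theorem tsum_sub_mul_exp (hL : GibbsSummable L) (E : ℝ) {β : ℝ} (hβ : 0 < β) :
    ∑' n, (L n - E) * Real.exp (-(β * L n)) =
      ∑' n, L n * Real.exp (-(β * L n)) - E * ∑' n, Real.exp (-(β * L n)) := by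
  simp_rw [sub_mul]
  rw [(hL.summable_mul_exp hβ).tsum_sub ((hL.summable_exp β hβ).mul_left E), tsum_mul_left]

theorem continuousOn_tsum_sub_mul_exp (hL : GibbsSummable L) (E : ℝ) {β₀ : ℝ} (hβ₀ : 0 < β₀) :
    ContinuousOn (fun β => ∑' n, (L n - E) * Real.exp (-(β * L n))) (Set.Ici β₀) := by
  refine continuousOn_tsum (u := fun n => (L n + |E|) * Real.exp (-(β₀ * L n)))
    (fun n => by fun_prop) ?_ (fun n β hβ => ?_)
  · simp_rw [add_mul]
    exact (hL.summable_mul_exp hβ₀).add ((hL.summable_exp β₀ hβ₀).mul_left _)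
  · rw [norm_mul, Real.norm_eq_abs, Real.norm_eq_abs, abs_of_pos (Real.exp_pos _)]
    have h1 : |L n - E| ≤ L n + |E| := by
      simpa [abs_of_nonneg (hL.nonneg n)] using abs_sub (L n) E
    have h2 : β₀ * L n ≤ β * L n := mul_le_mul_of_nonneg_right hβ (hL.nonneg n)
    have h3 : 0 ≤ L n + |E| := (abs_nonneg _).trans h1
    gcongr

/-- As `β → 0` the weights on a finite set tend to 1, and infinitely many levels exceed `E + 1`;
sufficiently many of them outweigh the finitely many levels below `E`. The bound `b` keeps the point
to the left of a given negative value. -/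
theorem exists_tsum_pos (hL : GibbsSummable L) (E : ℝ) (b : ℝ) (hb : 0 < b) :
    ∃ β, 0 < β ∧ β ≤ b ∧ 0 < ∑' n, (L n - E) * Real.exp (-(β * L n)) := by
  classical
  set F : Finset ℕ := (hL.finite_le E).toFinset with hF
  set G : Finset ℕ := (hL.finite_le (E + 1)).toFinset with hG
  obtain ⟨k, hk⟩ := exists_nat_gt (-∑ n ∈ F, (L n - E))
  have hinf : ({n | L n ≤ E + 1}ᶜ : Set ℕ).Infinite := (hL.finite_le (E + 1)).infinite_compl
  obtain ⟨T, hTs, hTc⟩ := hinf.exists_subset_card_eq k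
  have hT1 : ∀ n ∈ T, 1 ≤ L n - E := fun n hn => by
    have := hTs hn
    simp only [Set.mem_compl_iff, Set.mem_ofPred_eq, not_le] at this
    linarith
  have hdisj : Disjoint F T := by
    rw [Finset.disjoint_left]
    intro n hn hn'
    have h1 : L n ≤ E := by simpa [hF] using hn
    linarith [hT1 n hn']
  have hpos : 0 < ∑ n ∈ F ∪ T, (L n - E) * Real.exp (-((0 : ℝ) * L n)) := by
    simp only [zero_mul, neg_zero, Real.exp_zero, mul_one]
    rw [Finset.sum_union hdisj]
    have := Finset.card_nsmul_le_sum T (fun n => L n - E) 1 hT1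
    rw [hTc, nsmul_eq_mul, mul_one] at this
    linarith
  have hcont : Continuous fun β : ℝ => ∑ n ∈ F ∪ T, (L n - E) * Real.exp (-(β * L n)) := by
    fun_prop
  have hev := (hcont.tendsto 0).eventually_const_lt hpos
  have hev2 : ∀ᶠ β in nhdsWithin (0 : ℝ) (Set.Ioi 0), β ∈ Set.Ioo 0 b := Ioo_mem_nhdsGT hb
  obtain ⟨β, h1, h2⟩ := ((hev.filter_mono nhdsWithin_le_nhds).and hev2).exists
  refine ⟨β, h2.1, h2.2.le, h1.trans_le ?_⟩
  -- Every level at most `E` lies in `F`, so the omitted terms are nonnegative.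
  refine (hL.summable_sub_mul_exp E h2.1).sum_le_tsum _ (fun n hn => ?_)
  have h3 : n ∉ F := fun h => hn (Finset.mem_union_left _ h)
  have h4 : E < L n := by simpa [hF] using h3
  exact mul_nonneg (by linarith) (Real.exp_pos _).le

/-- As `β → ∞` the sum of `L n e^{-β L n}` vanishes by dominated convergence, while the ground level
keeps the Boltzmann sum at least 1. -/
theorem exists_tsum_neg (hL : GibbsSummable L) {k : ℕ} (hk : L k = 0) {E : ℝ} (hE : 0 < E) :
    ∃ β, 0 < β ∧ ∑' n, (L n - E) * Real.exp (-(β * L n)) < 0 := by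
  have hlim : Filter.Tendsto (fun β => ∑' n, L n * Real.exp (-(β * L n))) Filter.atTop
      (nhds (∑' _ : ℕ, (0 : ℝ))) := by
    refine tendsto_tsum_of_dominated_convergence (hL.summable_mul_exp one_pos) (fun n => ?_) ?_
    · rcases (hL.nonneg n).eq_or_lt with h | h
      · simp [← h]
      · rw [← mul_zero (L n)]
        refine Filter.Tendsto.const_mul _ (Real.tendsto_exp_neg_atTop_nhds_zero.comp ?_)
        exact Filter.tendsto_id.atTop_mul_const h
    · filter_upwards [Filter.eventually_ge_atTop (1 : ℝ)] with β hβ n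
      rw [Real.norm_of_nonneg (mul_nonneg (hL.nonneg n) (Real.exp_pos _).le)]
      have h2 : 1 * L n ≤ β * L n := mul_le_mul_of_nonneg_right hβ (hL.nonneg n)
      have := hL.nonneg n
      gcongr
  rw [tsum_zero] at hlim
  obtain ⟨β, h1, h2⟩ := ((hlim.eventually_lt_const hE).and (Filter.eventually_gt_atTop 0)).exists
  refine ⟨β, h2, ?_⟩
  rw [hL.tsum_sub_mul_exp E h2]
  nlinarith [hL.one_le_tsum hk h2]

theorem exists_tsum_eq_zero (hL : GibbsSummable L) {k : ℕ} (hk : L k = 0) {E : ℝ} (hE : 0 < E) :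
    ∃ β, 0 < β ∧ ∑' n, (L n - E) * Real.exp (-(β * L n)) = 0 := by
  obtain ⟨b, hb, hneg⟩ := hL.exists_tsum_neg hk hE
  obtain ⟨c, hc, hcb, hpos⟩ := hL.exists_tsum_pos E b hb
  obtain ⟨β, hβ, h⟩ := intermediate_value_Icc' hcb
    ((hL.continuousOn_tsum_sub_mul_exp E hc).mono Set.Icc_subset_Ici_self)
    (show (0 : ℝ) ∈ _ from ⟨hneg.le, hpos.le⟩)
  exact ⟨β, hc.trans_le hβ.1, h⟩

/-- Strict variational characterization of the inverse temperature. -/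
theorem free_energy_lt (hL : GibbsSummable L) {E β β' : ℝ} (hβ : 0 < β) (hβ' : 0 < β')
    (hne : β' ≠ β) (h0 : ∑' n, (L n - E) * Real.exp (-(β * L n)) = 0) :
    β * E + Real.log (∑' n, Real.exp (-(β * L n))) <
      β' * E + Real.log (∑' n, Real.exp (-(β' * L n))) := by
  set δ := β' - β with hδ
  have hδ0 : δ ≠ 0 := sub_ne_zero.2 hne
  have hs := (hL.summable_exp β hβ)
  have hs' := (hL.summable_exp β' hβ')
  have hZ : 0 < ∑' n, Real.exp (-(β * L n)) := hs.tsum_pos (fun n => (Real.exp_pos _).le) 0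
    (Real.exp_pos _)
  have hZ' : 0 < ∑' n, Real.exp (-(β' * L n)) := hs'.tsum_pos (fun n => (Real.exp_pos _).le) 0
    (Real.exp_pos _)
  have heq : ∀ n, Real.exp (δ * E) * Real.exp (-(β' * L n)) =
      Real.exp (-(β * L n)) * Real.exp (-δ * (L n - E)) := fun n => by
    rw [← Real.exp_add, ← Real.exp_add]; congr 1; rw [hδ]; ring
  obtain ⟨m, hm⟩ : ∃ m, L m ≠ E := by
    obtain ⟨m, hm⟩ := (hL.finite_le E).infinite_compl.nonempty
    exact ⟨m, fun h => hm h.le⟩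
  -- This is `e^x ≥ 1 + x` at `x = -δ (L n - E)`, weighted by `e^{-β L n}`. The linear part sums to
  -- zero by `h0`, and the level `m` off `E` makes the inequality strict.
  have hlt : ∑' n, (Real.exp (-(β * L n)) - δ * ((L n - E) * Real.exp (-(β * L n)))) <
      ∑' n, Real.exp (δ * E) * Real.exp (-(β' * L n)) := by
    refine Summable.tsum_lt_tsum (i := m) (fun n => ?_) ?_
      (hs.sub ((hL.summable_sub_mul_exp E hβ).mul_left δ)) (hs'.mul_left _)
    · rw [heq]
      have := mul_le_mul_of_nonneg_left (Real.add_one_le_exp (-δ * (L n - E)))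
        (Real.exp_pos (-(β * L n))).le
      linarith
    · rw [heq]
      have := mul_lt_mul_of_pos_left (Real.add_one_lt_exp
        (mul_ne_zero (neg_ne_zero.2 hδ0) (sub_ne_zero.2 hm))) (Real.exp_pos (-(β * L m)))
      linarith
  rw [hs.tsum_sub ((hL.summable_sub_mul_exp E hβ).mul_left δ), tsum_mul_left, tsum_mul_left, h0,
    mul_zero, sub_zero] at hlt
  have := Real.log_lt_log hZ hlt
  rw [Real.log_mul (Real.exp_pos _).ne' hZ'.ne', Real.log_exp] at this
  rw [hδ] at this
  linarith

/-- The number of ground levels is below every Boltzmann sum. -/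
theorem card_lt_tsum (hL : GibbsSummable L) {β : ℝ} (hβ : 0 < β) :
    (∑' n, if L n = 0 then (1 : ℝ) else 0) < ∑' n, Real.exp (-(β * L n)) := by
  obtain ⟨m, hm⟩ := (hL.finite_le 0).infinite_compl.nonempty
  have hm' : L m ≠ 0 := fun h => hm h.le
  have hle : ∀ n, (if L n = 0 then (1 : ℝ) else 0) ≤ Real.exp (-(β * L n)) := fun n => by
    split_ifs with h
    · simp [h]
    · exact (Real.exp_pos _).le
  have hs := hL.summable_exp β hβ
  refine Summable.tsum_lt_tsum (i := m) hle ?_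
    (Summable.of_nonneg_of_le (fun n => by split_ifs <;> simp) hle hs) hs
  simpa [hm'] using Real.exp_pos _

theorem summable_ground (hL : GibbsSummable L) :
    Summable fun n => if L n = 0 then (1 : ℝ) else 0 := by
  refine Summable.of_nonneg_of_le (fun n => by split_ifs <;> simp) (fun n => ?_)
    (hL.summable_exp 1 one_pos)
  split_ifs with h
  · simp [h]
  · exact (Real.exp_pos _).le

theorem one_le_tsum_ground (hL : GibbsSummable L) {k : ℕ} (hk : L k = 0) :
    1 ≤ ∑' n, if L n = 0 then (1 : ℝ) else 0 := by
  have h := hL.summable_ground.le_tsum k (fun n _ => by split_ifs <;> simp)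
  simpa [hk] using h

end GibbsSummable
end GibbsEntropy

noncomputable section

namespace GibbsEntropy

variable {A : Type*} [NormedAddCommGroup A] [InnerProductSpace ℂ A] [CompleteSpace A]

/-! ## Functional calculus on eigenvectors and positive operators -/

/-- The claim is clear for polynomials in `T`; the functions satisfying it form a closed set, so
density suffices. -/
theorem cfc_apply_eigenvector {T : A →L[ℂ] A} (hT : IsSelfAdjoint T) {f : ℝ → ℝ}
    (hf : Continuous f) {x : A} {c : ℝ} (hx : T x = (c : ℂ) • x) :
    cfc f T x = (f c : ℂ) • x := by
  rcases eq_or_ne x 0 with rfl | hx0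
  · simp
  have hc : c ∈ spectrum ℝ T := by
    rw [spectrum.mem_iff]
    intro hu
    have h1 : (algebraMap ℝ (A →L[ℂ] A) c - T) x = 0 := by
      rw [Algebra.algebraMap_eq_smul_one]
      simp [hx]
    obtain ⟨u, hu⟩ := hu
    have h2 : ((↑u⁻¹ : A →L[ℂ] A) * u) x = 0 := by
      rw [hu, mul_apply_eq_comp, h1, map_zero]
    rw [Units.inv_mul] at h2
    exact hx0 (by simpa using h2)
  rw [cfc_apply f T hT hf.continuousOn]
  have key : ∀ g : C(spectrum ℝ T, ℝ), cfcHom hT g x = (g ⟨c, hc⟩ : ℂ) • x := by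
    intro g
    induction g using ContinuousMap.induction_on_of_compact with
    | const r =>
      have : (ContinuousMap.const (spectrum ℝ T) r) = algebraMap ℝ C(spectrum ℝ T, ℝ) r := by
        ext; simp
      rw [this, AlgHomClass.commutes, Algebra.algebraMap_eq_smul_one]
      simp
    | id =>
      rw [cfcHom_id hT]
      simpa using hx
    | star_id =>
      rw [map_star, cfcHom_id hT, hT.star_eq]
      simpa using hx
    | add f g hf hg => simp [map_add, hf, hg, add_smul]
    | mul f g hf hg =>
      rw [map_mul, mul_apply_eq_comp, hg, map_smul, hf, smul_smul, ContinuousMap.mul_apply,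
        Complex.ofReal_mul, mul_comm]
    | frequently f hf =>
      have hcl : IsClosed {g : C(spectrum ℝ T, ℝ) | cfcHom hT g x = (g ⟨c, hc⟩ : ℂ) • x} := by
        refine isClosed_eq ?_ ?_
        · exact ((ContinuousLinearMap.apply ℂ A x).continuous).comp (cfcHom_continuous hT)
        · exact (Complex.continuous_ofReal.comp (continuous_eval_const _)).smul
            continuous_const
      exact hcl.mem_of_frequently_of_tendsto hf Filter.tendsto_id
  exact key _

/-- The diagonal matrix element `⟨x|T|x⟩` as a real number. -/
def diagElem (T : A →L[ℂ] A) (x : A) : ℝ := RCLike.re ⟪x, T x⟫_ℂ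

theorem diagElem_nonneg {T : A →L[ℂ] A} (hT : T.IsPositive) (x : A) : 0 ≤ diagElem T x :=
  hT.re_inner_nonneg_right x

theorem diagElem_mono {S T : A →L[ℂ] A} (h : S ≤ T) (x : A) : diagElem S x ≤ diagElem T x := by
  have h1 := ((ContinuousLinearMap.le_def S T).1 h).re_inner_nonneg_right x
  simp only [sub_apply, inner_sub_right, map_sub, sub_nonneg] at h1
  exact h1

theorem trace_real_smul {c : ℝ} (hc : 0 ≤ c) (T : A →L[ℂ] A) :
    trace (c • T) = ENNReal.ofReal c * trace T := by
  rw [trace, trace, ← ENNReal.tsum_mul_left]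
  congr 1; ext e
  rw [← ENNReal.ofReal_mul hc]
  congr 1
  rw [smul_apply, ← Complex.coe_smul, inner_smul_right]
  simp

/-- The Hilbert–Schmidt norm of `R = √ρ` dominates its operator norm: ‖Rx‖² = ∑ |⟨R bᵢ, x⟩|² ≤ (tr
ρ) ‖x‖². This puts the spectrum in [0, 1], where -x log x is nonnegative. -/
theorem IsState.le_one {ρ : A →L[ℂ] A} (hρ : IsState ρ) : ρ ≤ 1 := by
  obtain ⟨hpos, htr⟩ := hρ
  have hT0 : 0 ≤ ρ := (ContinuousLinearMap.nonneg_iff_isPositive ρ).2 hpos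
  set R : A →L[ℂ] A := CFC.sqrt ρ with hR
  have hRsa : IsSelfAdjoint R := (CFC.sqrt_nonneg ρ).isSelfAdjoint
  have hRR : R * R = ρ := CFC.sqrt_mul_sqrt_self ρ hT0
  have hsym : ∀ x y : A, ⟪R x, y⟫_ℂ = ⟪x, R y⟫_ℂ := fun x y => hRsa.isSymmetric x y
  have key : ∀ x : A, RCLike.re ⟪x, ρ x⟫_ℂ = ‖R x‖ ^ 2 := by
    intro x
    rw [← hRR, mul_apply_eq_comp, ← hsym]
    exact inner_self_eq_norm_sq (𝕜 := ℂ) _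
  obtain ⟨w, b, -⟩ := exists_hilbertBasis ℂ A
  have hbound : ∀ x : A, ‖R x‖ ^ 2 ≤ ‖x‖ ^ 2 := fun x => by
    rw [← ENNReal.ofReal_le_ofReal_iff (by positivity), ← tsum_norm_inner_sq b]
    calc ∑' i, ENNReal.ofReal (‖⟪b i, R x⟫_ℂ‖ ^ 2)
        ≤ ∑' i, ENNReal.ofReal (RCLike.re ⟪b i, ρ (b i)⟫_ℂ) * ENNReal.ofReal (‖x‖ ^ 2) := by
          refine ENNReal.tsum_le_tsum fun i => ?_
          rw [← ENNReal.ofReal_mul (by rw [key]; positivity), key, ← hsym, ← mul_pow]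
          gcongr
          exact norm_inner_le_norm _ _
      _ = ENNReal.ofReal (‖x‖ ^ 2) := by
          rw [ENNReal.tsum_mul_right, ← trace_eq b hpos, htr, one_mul]
  rw [ContinuousLinearMap.le_def, ContinuousLinearMap.isPositive_iff_complex]
  intro x
  have hsa : IsSelfAdjoint (1 - ρ) := (IsSelfAdjoint.one _).sub hpos.isSelfAdjoint
  have hre : RCLike.re ⟪(1 - ρ) x, x⟫_ℂ = ‖x‖ ^ 2 - ‖R x‖ ^ 2 := by
    rw [inner_re_symm, ← key]
    simp only [sub_apply, inner_sub_right, map_sub]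
    congr 1
    exact inner_self_eq_norm_sq (𝕜 := ℂ) _
  refine ⟨?_, ?_⟩
  · exact hsa.isSymmetric.coe_re_inner_apply_self x
  · rw [hre, sub_nonneg]; exact hbound x

theorem spectrum_subset_Icc {ρ : A →L[ℂ] A} (hρ : IsState ρ) : spectrum ℝ ρ ⊆ Set.Icc 0 1 := by
  intro x hx
  refine ⟨?_, ?_⟩
  · exact spectrum_nonneg_of_nonneg ((ContinuousLinearMap.nonneg_iff_isPositive ρ).2 hρ.1) hx
  · exact (le_algebraMap_iff_spectrum_le (R := ℝ) (r := 1) (a := ρ) hρ.1.isSelfAdjoint).1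
      (by simpa using hρ.le_one) x hx

theorem cfc_negMulLog_isPositive {ρ : A →L[ℂ] A} (hρ : IsState ρ) :
    (cfc Real.negMulLog ρ).IsPositive := by
  rw [← ContinuousLinearMap.nonneg_iff_isPositive]
  exact cfc_nonneg fun x hx =>
    Real.negMulLog_nonneg (spectrum_subset_Icc hρ hx).1 (spectrum_subset_Icc hρ hx).2

/-- Positivity of -ρ log ρ makes its trace independent of the basis, so an eigenbasis of the
Hamiltonian may be used even if ρ does not commute with it. -/
theorem entropy_eq (a : ℝ) (ha : 1 < a) {ρ : A →L[ℂ] A} (hρ : IsState ρ) (b : HilbertBasis ℕ ℂ A) :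
    entropy a ρ = ENNReal.ofReal (Real.log a)⁻¹ *
      ∑' n, ENNReal.ofReal (diagElem (cfc Real.negMulLog ρ) (b n)) := by
  have h : (fun x : ℝ => -(x * Real.logb a x)) =
      fun x => (Real.log a)⁻¹ • Real.negMulLog x := by
    ext x; rw [Real.logb, Real.negMulLog, smul_eq_mul]; ring
  rw [entropy, h, cfc_smul (hf := Real.continuous_negMulLog.continuousOn), trace_real_smul
    (inv_nonneg.2 (Real.log_nonneg ha.le)), trace_eq b (cfc_negMulLog_isPositive hρ)]
  rfl

/-- The right side is the tangent at `q` of a concave function; the bound is `log y ≤ y - 1` at `y =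
q / x`. -/
theorem negMulLog_le_tangent {x q : ℝ} (hx : 0 ≤ x) (hq : 0 < q) :
    Real.negMulLog x ≤ (-Real.log q - 1) * x + q := by
  rcases hx.eq_or_lt with rfl | hx
  · simpa using hq.le
  have h := Real.log_le_sub_one_of_pos (div_pos hq hx)
  rw [Real.log_div hq.ne' hx.ne'] at h
  have h2 := mul_le_mul_of_nonneg_left h hx.le
  rw [mul_sub x (q / x), mul_div_cancel₀ q hx.ne'] at h2
  rw [Real.negMulLog]
  linarith

theorem diagElem_cfc_negMulLog_le {ρ : A →L[ℂ] A} (hρ : ρ.IsPositive) {q : ℝ} (hq : 0 < q)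
    {x : A} (hx : ‖x‖ = 1) :
    diagElem (cfc Real.negMulLog ρ) x ≤ (-Real.log q - 1) * diagElem ρ x + q := by
  have hsa : IsSelfAdjoint ρ := hρ.isSelfAdjoint
  have h : cfc Real.negMulLog ρ ≤ (-Real.log q - 1) • ρ + algebraMap ℝ (A →L[ℂ] A) q := by
    have : (-Real.log q - 1) • ρ + algebraMap ℝ (A →L[ℂ] A) q =
        cfc (fun x : ℝ => (-Real.log q - 1) * x + q) ρ := by
      rw [cfc_add_const q (fun x : ℝ => (-Real.log q - 1) * x) ρ, cfc_const_mul_id _ ρ]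
    rw [this]
    refine cfc_mono (fun x hx => negMulLog_le_tangent ?_ hq)
      Real.continuous_negMulLog.continuousOn (by fun_prop)
    exact spectrum_nonneg_of_nonneg ((ContinuousLinearMap.nonneg_iff_isPositive ρ).2 hρ) hx
  refine (diagElem_mono h x).trans_eq ?_
  rw [Algebra.algebraMap_eq_smul_one]
  simp only [diagElem, add_apply, inner_add_right, map_add,
    smul_apply, ← Complex.coe_smul, inner_smul_right,
    one_apply_eq_self, inner_self_eq_norm_sq_to_K, hx]
  simp

/-! ## Operators diagonal in a Hilbert basis -/

section Diagonal

variable {b : HilbertBasis ℕ ℂ A} {T : A →L[ℂ] A} {q : ℕ → ℝ}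

theorem diagElem_of_diagonal (hT : ∀ n, T (b n) = (q n : ℂ) • b n) (n : ℕ) :
    diagElem T (b n) = q n := by
  rw [diagElem, hT, inner_smul_right, inner_self_eq_norm_sq_to_K, b.orthonormal.1 n]
  simp

theorem isPositive_of_diagonal (hT : ∀ n, T (b n) = (q n : ℂ) • b n) (hq : ∀ n, 0 ≤ q n) :
    T.IsPositive := by
  rw [ContinuousLinearMap.isPositive_iff_complex]
  intro x
  have h : HasSum (fun n => ((q n * ‖b.repr x n‖ ^ 2 : ℝ) : ℂ)) ⟪x, T x⟫_ℂ := by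
    have h1 := (innerSL ℂ x).hasSum (T.hasSum (b.hasSum_repr x))
    refine h1.congr_fun fun n => ?_
    simp only [map_smul, hT, innerSL_apply_apply, smul_eq_mul]
    rw [← inner_conj_symm x (b n), ← b.repr_apply_apply, mul_left_comm, Complex.mul_conj']
    push_cast; rfl
  have h2 := Complex.hasSum_re h
  -- The quadratic form is a sum of real numbers, hence real.
  have h3 : ⟪x, T x⟫_ℂ = ((RCLike.re ⟪x, T x⟫_ℂ : ℝ) : ℂ) :=
    h.unique (Complex.hasSum_ofReal.2 h2)
  refine ⟨?_, ?_⟩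
  · rw [inner_re_symm, ← h3, ← inner_conj_symm (T x) x, h3]
    simp
  rw [inner_re_symm]
  refine h2.nonneg fun n => ?_
  rw [Complex.ofReal_re]
  exact mul_nonneg (hq n) (sq_nonneg _)

theorem trace_of_diagonal (hT : ∀ n, T (b n) = (q n : ℂ) • b n) (hq : ∀ n, 0 ≤ q n) :
    trace T = ∑' n, ENNReal.ofReal (q n) := by
  rw [trace_eq b (isPositive_of_diagonal hT hq)]
  exact tsum_congr fun n => congrArg _ (diagElem_of_diagonal hT n)

theorem isState_of_diagonal (hT : ∀ n, T (b n) = (q n : ℂ) • b n) (hq : ∀ n, 0 ≤ q n)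
    (h1 : HasSum q 1) : IsState T := by
  refine ⟨isPositive_of_diagonal hT hq, ?_⟩
  rw [trace_of_diagonal hT hq, ← ENNReal.ofReal_tsum_of_nonneg hq h1.summable, h1.tsum_eq,
    ENNReal.ofReal_one]

theorem entropy_of_diagonal (hT : ∀ n, T (b n) = (q n : ℂ) • b n) (hq : ∀ n, 0 ≤ q n)
    (h1 : HasSum q 1) {a : ℝ} (ha : 1 < a) {s : ℝ} (hs : HasSum (fun n => Real.negMulLog (q n)) s) :
    entropy a T = ENNReal.ofReal ((Real.log a)⁻¹ * s) := by
  have hle : ∀ n, q n ≤ 1 := fun n => le_hasSum h1 n fun m _ => hq m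
  have hst := isState_of_diagonal hT hq h1
  rw [entropy_eq a ha hst b, ENNReal.ofReal_mul (inv_nonneg.2 (Real.log_nonneg ha.le)),
    ← hs.tsum_eq, ENNReal.ofReal_tsum_of_nonneg
      (fun n => Real.negMulLog_nonneg (hq n) (hle n)) hs.summable]
  congr 1
  refine tsum_congr fun n => congrArg _ (diagElem_of_diagonal (q := fun n => Real.negMulLog (q n))
    (fun n => cfc_apply_eigenvector hst.1.isSelfAdjoint Real.continuous_negMulLog (hT n)) n)

end Diagonal

end GibbsEntropy
end

noncomputable section

namespace GibbsEntropy

variable {A : Type*} [NormedAddCommGroup A] [InnerProductSpace ℂ A] [CompleteSpace A]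

namespace Hamiltonian

variable (H : Hamiltonian A)

/-! ## Partition function and energy -/

/-- The partition function as a real number. -/
def boltzmannSum (β : ℝ) : ℝ := ∑' n, Real.exp (-(β * H.level n))

/-- The dimension of the ground space, as a real number. -/
def degeneracy : ℝ := by
  classical exact ∑' n, if H.level n = 0 then (1 : ℝ) else 0

theorem expNeg_basis (β : ℝ≥0) (n : ℕ) :
    H.expNeg β (H.basis n) = (Real.exp (-(β * H.level n)) : ℂ) • H.basis n := by
  rw [expNeg, diagonal_basis]

theorem partition_eq_tsum (β : ℝ≥0) :
    H.partition β = ∑' n, ENNReal.ofReal (Real.exp (-(β * H.level n))) :=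
  trace_of_diagonal (H.expNeg_basis β) fun _ => (Real.exp_pos _).le

theorem energy_eq_tsum (ρ : A →L[ℂ] A) :
    H.energy ρ = ∑' n, ENNReal.ofReal (H.level n * diagElem ρ (H.basis n)) := by
  refine tsum_congr fun n => congrArg _ ?_
  rw [H.op_basis, map_smul, inner_smul_right, diagElem]
  simp

theorem energy_of_diagonal {T : A →L[ℂ] A} {q : ℕ → ℝ}
    (hT : ∀ n, T (H.basis n) = (q n : ℂ) • H.basis n) (hq : ∀ n, 0 ≤ q n) {u : ℝ}
    (hu : HasSum (fun n => H.level n * q n) u) : H.energy T = ENNReal.ofReal u := by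
  rw [energy_eq_tsum, ← hu.tsum_eq, ENNReal.ofReal_tsum_of_nonneg
    (fun n => mul_nonneg (H.level_nonneg n) (hq n)) hu.summable]
  exact tsum_congr fun n => by rw [diagElem_of_diagonal hT n]

variable {H}

theorem GibbsHypothesis.gibbsSummable (hH : H.GibbsHypothesis) : GibbsSummable H.level := by
  refine ⟨H.level_nonneg, fun β hβ => ?_⟩
  have h := hH ⟨β, hβ.le⟩ hβ
  lift β to ℝ≥0 using hβ.le
  rw [show (⟨β, _⟩ : ℝ≥0) = β from rfl, partition_eq_tsum] at h
  exact (ENNReal.summable_toReal h.ne).congr fun n => ENNReal.toReal_ofReal (Real.exp_pos _).le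

theorem GibbsHypothesis.partition_eq (hH : H.GibbsHypothesis) {β : ℝ≥0} (hβ : 0 < β) :
    H.partition β = ENNReal.ofReal (H.boltzmannSum β) := by
  rw [partition_eq_tsum, boltzmannSum, ENNReal.ofReal_tsum_of_nonneg
    (fun n => (Real.exp_pos _).le) (hH.gibbsSummable.summable_exp β (NNReal.coe_pos.2 hβ))]

theorem GibbsHypothesis.one_le_boltzmannSum (hH : H.GibbsHypothesis) {β : ℝ} (hβ : 0 < β) :
    1 ≤ H.boltzmannSum β := by
  obtain ⟨k, hk⟩ := H.exists_level_eq_zero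
  exact hH.gibbsSummable.one_le_tsum hk hβ

theorem GibbsHypothesis.isInverseTemperature_iff (hH : H.GibbsHypothesis) {E : ℝ} (hE : 0 < E)
    {β : ℝ≥0} : H.IsInverseTemperature E β ↔
      0 < β ∧ ∑' n, (H.level n - E) * Real.exp (-(β * H.level n)) = 0 := by
  refine and_congr_right fun hβ => ?_
  have hβ' : (0 : ℝ) < β := NNReal.coe_pos.2 hβ
  have hs := hH.gibbsSummable.summable_mul_exp hβ'
  rw [hH.partition_eq hβ, hH.gibbsSummable.tsum_sub_mul_exp E hβ', sub_eq_zero,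
    H.energy_of_diagonal (H.expNeg_basis β) (fun n => (Real.exp_pos _).le) hs.hasSum,
    ← ENNReal.ofReal_mul hE.le]
  -- `ENNReal.ofReal` is injective only on nonnegative reals.
  refine ENNReal.ofReal_eq_ofReal_iff ?_ ?_
  · exact tsum_nonneg fun n => mul_nonneg (H.level_nonneg n) (Real.exp_pos _).le
  · exact mul_nonneg hE.le (zero_le_one.trans (hH.one_le_boltzmannSum hβ'))

theorem GibbsHypothesis.existsUnique_inverseTemperature (hH : H.GibbsHypothesis) {E : ℝ}
    (hE : 0 < E) : ∃! β : ℝ≥0, H.IsInverseTemperature E β := by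
  obtain ⟨k, hk⟩ := H.exists_level_eq_zero
  obtain ⟨β, hβ, h⟩ := hH.gibbsSummable.exists_tsum_eq_zero hk hE
  refine ⟨⟨β, hβ.le⟩, (hH.isInverseTemperature_iff hE).2 ⟨hβ, h⟩, fun β' h' => ?_⟩
  obtain ⟨hβ', h'⟩ := (hH.isInverseTemperature_iff hE).1 h'
  by_contra hne
  have hne' : (β' : ℝ) ≠ β := fun h => hne (NNReal.eq h)
  rw [← NNReal.coe_pos] at hβ'
  -- Each of two distinct roots would give a strictly smaller value of βE + log Z(β) than the other.
  exact lt_asymm (hH.gibbsSummable.free_energy_lt hβ hβ' hne' h)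
    (hH.gibbsSummable.free_energy_lt hβ' hβ hne'.symm h')

theorem GibbsHypothesis.isInverseTemperature (hH : H.GibbsHypothesis) {E : ℝ} (hE : 0 < E) :
    H.IsInverseTemperature E (H.inverseTemperature E) := by
  have h := (hH.existsUnique_inverseTemperature hE).exists
  rw [inverseTemperature, dif_pos h]
  exact h.choose_spec

theorem GibbsHypothesis.inverseTemperature_pos (hH : H.GibbsHypothesis) {E : ℝ} (hE : 0 < E) :
    0 < (H.inverseTemperature E : ℝ) := NNReal.coe_pos.2 (hH.isInverseTemperature hE).1

theorem GibbsHypothesis.tsum_inverseTemperature (hH : H.GibbsHypothesis) {E : ℝ} (hE : 0 < E) :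
    ∑' n, (H.level n - E) * Real.exp (-(H.inverseTemperature E * H.level n)) = 0 :=
  ((hH.isInverseTemperature_iff hE).1 (hH.isInverseTemperature hE)).2

theorem GibbsHypothesis.tsum_level_mul_exp (hH : H.GibbsHypothesis) {E : ℝ} (hE : 0 < E) :
    ∑' n, H.level n * Real.exp (-(H.inverseTemperature E * H.level n)) =
      E * H.boltzmannSum (H.inverseTemperature E) := by
  have h := hH.tsum_inverseTemperature hE
  rwa [hH.gibbsSummable.tsum_sub_mul_exp E (hH.inverseTemperature_pos hE), sub_eq_zero] at h

/-- The energy is recovered from β as the Boltzmann mean of the levels. -/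
theorem GibbsHypothesis.inverseTemperature_injOn (hH : H.GibbsHypothesis) {E E' : ℝ}
    (hE : 0 < E) (hE' : 0 < E') (h : H.inverseTemperature E = H.inverseTemperature E') :
    E = E' := by
  have h1 := hH.tsum_level_mul_exp hE
  rw [h, hH.tsum_level_mul_exp hE'] at h1
  have h2 := hH.one_le_boltzmannSum (hH.inverseTemperature_pos hE')
  exact (mul_right_cancel₀ (by linarith : H.boltzmannSum _ ≠ 0) h1).symm

/-! ## Gibbs states -/

open Classical in
variable (H) in
/-- The eigenvalues of the Gibbs state. -/
def gibbsWeight (E : ℝ) (n : ℕ) : ℝ :=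
  if 0 < E then Real.exp (-(H.inverseTemperature E * H.level n)) /
    H.boltzmannSum (H.inverseTemperature E)
  else (if H.level n = 0 then 1 else 0) / H.degeneracy

variable (H) in
/-- The entropy of the Gibbs state, with natural logarithms. -/
def gibbsEntropy (E : ℝ) : ℝ :=
  if 0 < E then H.inverseTemperature E * E + Real.log (H.boltzmannSum (H.inverseTemperature E))
  else Real.log H.degeneracy

theorem GibbsHypothesis.one_le_degeneracy (hH : H.GibbsHypothesis) : 1 ≤ H.degeneracy := by
  classical
  obtain ⟨k, hk⟩ := H.exists_level_eq_zero
  exact hH.gibbsSummable.one_le_tsum_ground hk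

theorem groundProjector_basis (n : ℕ) [Decidable (H.level n = 0)] : H.groundProjector (H.basis n) =
    ((if H.level n = 0 then 1 else 0 : ℝ) : ℂ) • H.basis n := by
  rw [groundProjector, diagonal_basis]; congr!

theorem GibbsHypothesis.trace_groundProjector (hH : H.GibbsHypothesis) :
    (trace H.groundProjector).toReal = H.degeneracy := by
  classical
  rw [trace_of_diagonal (fun n => groundProjector_basis n) (fun n => by split_ifs <;> simp),
    ← ENNReal.ofReal_tsum_of_nonneg (fun n => by split_ifs <;> simp)
      hH.gibbsSummable.summable_ground, ENNReal.toReal_ofReal]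
  · rw [degeneracy]
  · exact tsum_nonneg fun n => by split_ifs <;> simp

theorem GibbsHypothesis.gibbsState_basis (hH : H.GibbsHypothesis) (E : ℝ) (n : ℕ) :
    H.gibbsState E (H.basis n) = (H.gibbsWeight E n : ℂ) • H.basis n := by
  classical
  rw [gibbsState, gibbsWeight]
  split_ifs with hE h0
  · have hβ := hH.inverseTemperature_pos hE
    rw [smul_apply, expNeg_basis, smul_smul, hH.partition_eq (hH.isInverseTemperature hE).1, ENNReal.toReal_ofReal
      (zero_le_one.trans (hH.one_le_boltzmannSum hβ)), div_eq_inv_mul]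
    push_cast; rfl
  · rw [smul_apply, groundProjector_basis, smul_smul, hH.trace_groundProjector]
    simp [h0]
  · rw [smul_apply, groundProjector_basis, smul_smul, hH.trace_groundProjector]
    simp [h0]

theorem GibbsHypothesis.gibbsWeight_nonneg (hH : H.GibbsHypothesis) (E : ℝ) (n : ℕ) :
    0 ≤ H.gibbsWeight E n := by
  rw [gibbsWeight]
  have := hH.one_le_degeneracy
  split_ifs with hE
  · have := hH.one_le_boltzmannSum (hH.inverseTemperature_pos hE)
    positivity
  · positivity
  · simp

theorem GibbsHypothesis.hasSum_gibbsWeight (hH : H.GibbsHypothesis) (E : ℝ) :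
    HasSum (H.gibbsWeight E) 1 := by
  classical
  by_cases hE : 0 < E
  · have hβ := hH.inverseTemperature_pos hE
    have h1 := hH.one_le_boltzmannSum hβ
    have h := (hH.gibbsSummable.summable_exp _ hβ).hasSum.div_const
      (H.boltzmannSum (H.inverseTemperature E))
    rw [show ∑' n, Real.exp (-(H.inverseTemperature E * H.level n)) = H.boltzmannSum _ from rfl,
      div_self (by linarith)] at h
    exact h.congr_fun fun n => by rw [gibbsWeight, if_pos hE]
  · have h1 := hH.one_le_degeneracy
    have h := hH.gibbsSummable.summable_ground.hasSum.div_const H.degeneracy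
    rw [show (∑' n, if H.level n = 0 then (1 : ℝ) else 0) = H.degeneracy by
      rw [degeneracy], div_self (by linarith)] at h
    exact h.congr_fun fun n => by rw [gibbsWeight, if_neg hE]

theorem GibbsHypothesis.isState_gibbsState (hH : H.GibbsHypothesis) (E : ℝ) :
    IsState (H.gibbsState E) :=
  isState_of_diagonal (hH.gibbsState_basis E) (hH.gibbsWeight_nonneg E) (hH.hasSum_gibbsWeight E)

theorem GibbsHypothesis.hasSum_level_mul_gibbsWeight (hH : H.GibbsHypothesis) {E : ℝ}
    (hE : 0 ≤ E) : HasSum (fun n => H.level n * H.gibbsWeight E n) E := by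
  rcases hE.eq_or_lt with rfl | hE
  · refine hasSum_zero.congr_fun fun n => ?_
    rw [gibbsWeight, if_neg (lt_irrefl _)]
    split_ifs with h <;> simp [h]
  · have hβ := hH.inverseTemperature_pos hE
    have h1 := hH.one_le_boltzmannSum hβ
    have h := (hH.gibbsSummable.summable_mul_exp hβ).hasSum.div_const
      (H.boltzmannSum (H.inverseTemperature E))
    rw [hH.tsum_level_mul_exp hE, mul_div_cancel_right₀ _ (by linarith)] at h
    exact h.congr_fun fun n => by rw [gibbsWeight, if_pos hE, mul_div_assoc]

theorem GibbsHypothesis.energy_gibbsState (hH : H.GibbsHypothesis) {E : ℝ} (hE : 0 ≤ E) :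
    H.energy (H.gibbsState E) = ENNReal.ofReal E :=
  H.energy_of_diagonal (hH.gibbsState_basis E) (hH.gibbsWeight_nonneg E)
    (hH.hasSum_level_mul_gibbsWeight hE)

theorem GibbsHypothesis.neg_log_gibbsWeight (hH : H.GibbsHypothesis) {E : ℝ} (hE : 0 < E) (n : ℕ) :
    -Real.log (H.gibbsWeight E n) = H.inverseTemperature E * H.level n +
      Real.log (H.boltzmannSum (H.inverseTemperature E)) := by
  have h1 := hH.one_le_boltzmannSum (hH.inverseTemperature_pos hE)
  rw [gibbsWeight, if_pos hE, Real.log_div (Real.exp_pos _).ne' (by linarith), Real.log_exp]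
  ring

theorem GibbsHypothesis.gibbsEntropy_nonneg (hH : H.GibbsHypothesis) (E : ℝ) :
    0 ≤ H.gibbsEntropy E := by
  rw [gibbsEntropy]
  split_ifs with hE
  · have := Real.log_nonneg (hH.one_le_boltzmannSum (hH.inverseTemperature_pos hE))
    positivity
  · exact Real.log_nonneg hH.one_le_degeneracy

theorem GibbsHypothesis.hasSum_negMulLog_gibbsWeight (hH : H.GibbsHypothesis) {E : ℝ}
    (hE : 0 ≤ E) : HasSum (fun n => Real.negMulLog (H.gibbsWeight E n)) (H.gibbsEntropy E) := by
  rcases hE.eq_or_lt with rfl | hE'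
  · have h := (hH.hasSum_gibbsWeight 0).mul_right (Real.log H.degeneracy)
    rw [one_mul] at h
    rw [gibbsEntropy, if_neg (lt_irrefl _)]
    refine h.congr_fun fun n => ?_
    rw [gibbsWeight, if_neg (lt_irrefl _)]
    split_ifs with h0
    · rw [Real.negMulLog, one_div, Real.log_inv]; ring
    · simp
  · have h := ((hH.hasSum_level_mul_gibbsWeight hE).mul_left (H.inverseTemperature E : ℝ)).add
      ((hH.hasSum_gibbsWeight E).mul_left
        (Real.log (H.boltzmannSum (H.inverseTemperature E))))
    rw [mul_one] at h
    rw [gibbsEntropy, if_pos hE']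
    refine h.congr_fun fun n => ?_
    have := hH.neg_log_gibbsWeight hE' n
    rw [Real.negMulLog, neg_mul, ← mul_neg, this]; ring

theorem GibbsHypothesis.entropy_gibbsState (hH : H.GibbsHypothesis) {a : ℝ} (ha : 1 < a) {E : ℝ}
    (hE : 0 ≤ E) :
    entropy a (H.gibbsState E) = ENNReal.ofReal ((Real.log a)⁻¹ * H.gibbsEntropy E) :=
  entropy_of_diagonal (hH.gibbsState_basis E) (hH.gibbsWeight_nonneg E) (hH.hasSum_gibbsWeight E)
    ha (hH.hasSum_negMulLog_gibbsWeight hE)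

/-! ## The variational principle -/

/-- Gibbs' inequality `S(ρ) ≤ c tr ρH + d` from a comparison state with eigenvalues
`q n = e^{-(c Eₙ + d)}`. -/
theorem entropy_le_of_weight {ρ : A →L[ℂ] A} (hρ : IsState ρ) {a : ℝ} (ha : 1 < a) {q : ℕ → ℝ}
    (hq : ∀ n, 0 ≤ q n) (hq1 : HasSum q 1) {c d E : ℝ} (hc : 0 ≤ c) (hd : 0 ≤ d) (hE : 0 ≤ E)
    (hlog : ∀ n, (0 < q n ∧ -Real.log (q n) = c * H.level n + d) ∨ diagElem ρ (H.basis n) = 0)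
    (hρE : H.energy ρ ≤ ENNReal.ofReal E) :
    entropy a ρ ≤ ENNReal.ofReal ((Real.log a)⁻¹ * (c * E + d)) := by
  set D : ℕ → ℝ := fun n => diagElem (cfc Real.negMulLog ρ) (H.basis n) with hDdef
  set p : ℕ → ℝ := fun n => diagElem ρ (H.basis n) with hpdef
  have hp : ∀ n, 0 ≤ p n := fun n => diagElem_nonneg hρ.1 _
  have hD : ∀ n, 0 ≤ D n := fun n => diagElem_nonneg (cfc_negMulLog_isPositive hρ) _
  -- This is the tangent bound at `q n`, with its `-p n` moved to the left to avoid subtraction in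
  -- [0, ∞]. After summation `p` and `q` both contribute 1, which cancels.
  have hb : ∀ n, D n + p n ≤ c * (H.level n * p n) + d * p n + q n := fun n => by
    rcases hlog n with ⟨h0, hl⟩ | h0
    · have h := diagElem_cfc_negMulLog_le hρ.1 h0 (H.basis.orthonormal.1 n)
      rw [hl] at h
      change D n ≤ _ * p n + q n at h
      linarith
    -- No positive weight need be available here; the tangent point `ε` tends to 0 instead.
    · have h : D n ≤ 0 := le_of_forall_pos_le_add fun ε hε => by
        have h := diagElem_cfc_negMulLog_le hρ.1 hε (H.basis.orthonormal.1 n)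
        rwa [h0, mul_zero] at h
      have h0' : p n = 0 := h0
      rw [h0']
      linarith [hq n]
  have hp1 : ∑' n, ENNReal.ofReal (p n) = 1 := by rw [← hρ.2, trace_eq H.basis hρ.1]; rfl
  have hq1' : ∑' n, ENNReal.ofReal (q n) = 1 := by
    rw [← ENNReal.ofReal_tsum_of_nonneg hq hq1.summable, hq1.tsum_eq, ENNReal.ofReal_one]
  have hsum : ∑' n, ENNReal.ofReal (D n) + 1 ≤ ENNReal.ofReal (c * E + d) + 1 := by
    calc ∑' n, ENNReal.ofReal (D n) + 1
        = ∑' n, ENNReal.ofReal (D n + p n) := by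
          rw [← hp1, ← ENNReal.tsum_add]
          exact tsum_congr fun n => (ENNReal.ofReal_add (hD n) (hp n)).symm
      _ ≤ ∑' n, ENNReal.ofReal (c * (H.level n * p n) + d * p n + q n) :=
          ENNReal.tsum_le_tsum fun n => ENNReal.ofReal_le_ofReal (hb n)
      _ = ENNReal.ofReal c * H.energy ρ + ENNReal.ofReal d + 1 := by
          have hL := fun n => mul_nonneg (H.level_nonneg n) (hp n)
          have e : ∀ n, ENNReal.ofReal (c * (H.level n * p n) + d * p n + q n) =
              ENNReal.ofReal c * ENNReal.ofReal (H.level n * p n) +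
                ENNReal.ofReal d * ENNReal.ofReal (p n) + ENNReal.ofReal (q n) := fun n => by
            rw [ENNReal.ofReal_add (add_nonneg (mul_nonneg hc (hL n)) (mul_nonneg hd (hp n)))
              (hq n), ENNReal.ofReal_add (mul_nonneg hc (hL n)) (mul_nonneg hd (hp n)),
              ENNReal.ofReal_mul hc, ENNReal.ofReal_mul hd]
          simp_rw [e]
          rw [ENNReal.tsum_add, ENNReal.tsum_add, ENNReal.tsum_mul_left, ENNReal.tsum_mul_left,
            hp1, hq1', mul_one, energy_eq_tsum]
      _ ≤ ENNReal.ofReal (c * E + d) + 1 := by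
          rw [ENNReal.ofReal_add (mul_nonneg hc hE) hd, ENNReal.ofReal_mul hc]
          gcongr
  rw [entropy_eq a ha hρ H.basis, ENNReal.ofReal_mul (inv_nonneg.2 (Real.log_nonneg ha.le))]
  gcongr
  exact (ENNReal.add_le_add_iff_right ENNReal.one_ne_top).1 hsum

theorem GibbsHypothesis.entropy_le (hH : H.GibbsHypothesis) {a : ℝ} (ha : 1 < a) {E : ℝ}
    (hE : 0 ≤ E) {ρ : A →L[ℂ] A} (hρ : IsState ρ) (hρE : H.energy ρ ≤ ENNReal.ofReal E) :
    entropy a ρ ≤ entropy a (H.gibbsState E) := by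
  rw [hH.entropy_gibbsState ha hE]
  rcases hE.eq_or_lt with rfl | hE'
  · have h0 := hH.one_le_degeneracy
    have h := entropy_le_of_weight (H := H) hρ ha (hH.gibbsWeight_nonneg 0)
      (hH.hasSum_gibbsWeight 0) le_rfl (Real.log_nonneg h0) le_rfl (fun n => ?_) hρE
    · rw [gibbsEntropy, if_neg (lt_irrefl _)]
      rwa [zero_mul, zero_add] at h
    · by_cases hn : H.level n = 0
      · left
        rw [gibbsWeight, if_neg (lt_irrefl _), if_pos hn, one_div, Real.log_inv]
        exact ⟨by positivity, by ring⟩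
      · right
        -- Zero energy kills each term of the energy sum, so `ρ` has no weight on excited levels.
        rw [ENNReal.ofReal_zero, nonpos_iff_eq_zero, energy_eq_tsum, ENNReal.tsum_eq_zero] at hρE
        have h1 := ENNReal.ofReal_eq_zero.1 (hρE n)
        have h2 := (H.level_nonneg n).lt_of_ne' hn
        exact le_antisymm (nonpos_of_mul_nonpos_right h1 h2) (diagElem_nonneg hρ.1 _)
  · have h0 := hH.one_le_boltzmannSum (hH.inverseTemperature_pos hE')
    rw [gibbsEntropy, if_pos hE']
    refine entropy_le_of_weight (H := H) hρ ha (hH.gibbsWeight_nonneg E)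
      (hH.hasSum_gibbsWeight E) (NNReal.coe_nonneg _) (Real.log_nonneg h0) hE (fun n => ?_) hρE
    refine Or.inl ⟨?_, hH.neg_log_gibbsWeight hE' n⟩
    rw [gibbsWeight, if_pos hE']
    positivity

/-! ### Tangent lines of the entropy curve: strict monotonicity and concavity -/

theorem GibbsHypothesis.gibbsEntropy_lt (hH : H.GibbsHypothesis) {E : ℝ} (hE : 0 ≤ E) {β : ℝ≥0}
    (hβ : 0 < β) (hne : 0 < E → β ≠ H.inverseTemperature E) :
    H.gibbsEntropy E < β * E + Real.log (H.boltzmannSum β) := by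
  classical
  rcases hE.eq_or_lt with rfl | hE'
  · rw [gibbsEntropy, if_neg (lt_irrefl _), mul_zero, zero_add]
    refine Real.log_lt_log (zero_lt_one.trans_le hH.one_le_degeneracy) ?_
    convert hH.gibbsSummable.card_lt_tsum (NNReal.coe_pos.2 hβ)
    rw [degeneracy]; congr!
  · rw [gibbsEntropy, if_pos hE']
    exact hH.gibbsSummable.free_energy_lt (hH.inverseTemperature_pos hE') (NNReal.coe_pos.2 hβ)
      (fun h => hne hE' (NNReal.eq h)) (hH.tsum_inverseTemperature hE')

/-- Take β = β(E') in the strict minimum at `E`; injectivity of the inverse temperature excludes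
equality. -/
theorem GibbsHypothesis.gibbsEntropy_lt_of_ne (hH : H.GibbsHypothesis) {E E' : ℝ} (hE : 0 ≤ E)
    (hE' : 0 < E') (hne : E ≠ E') :
    H.gibbsEntropy E < H.gibbsEntropy E' + H.inverseTemperature E' * (E - E') := by
  have h := hH.gibbsEntropy_lt hE (hH.isInverseTemperature hE').1
    fun h h1 => hne (hH.inverseTemperature_injOn h hE' h1.symm)
  rw [gibbsEntropy.eq_1 H E', if_pos hE']
  linarith

theorem GibbsHypothesis.strictMonoOn_gibbsEntropy (hH : H.GibbsHypothesis) :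
    StrictMonoOn H.gibbsEntropy (Set.Ici 0) := fun E hE E' _ h => by
  have hE' : 0 < E' := lt_of_le_of_lt hE h
  have h1 := hH.gibbsEntropy_lt_of_ne hE hE' h.ne
  have h2 : (H.inverseTemperature E' : ℝ) * (E - E') ≤ 0 :=
    mul_nonpos_of_nonneg_of_nonpos (NNReal.coe_nonneg _) (by linarith)
  linarith

theorem GibbsHypothesis.strictConcaveOn_gibbsEntropy (hH : H.GibbsHypothesis) :
    StrictConcaveOn ℝ (Set.Ici 0) H.gibbsEntropy := by
  refine ⟨convex_Ici 0, fun x hx y hy hxy s t hs ht hst => ?_⟩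
  simp only [smul_eq_mul]
  simp only [Set.mem_Ici] at hx hy
  obtain rfl : t = 1 - s := by linarith
  set z := s * x + (1 - s) * y with hz
  -- The tangent point must be positive, since the tangent bound is available only there; the
  -- endpoint `x` or `y` may be 0.
  have hz0 : 0 < z := by
    rcases hx.eq_or_lt with rfl | hx'
    · have hy' : 0 < y := hy.lt_of_ne hxy
      positivity
    · positivity
  have hxz : x ≠ z := fun h => hxy (mul_left_cancel₀ ht.ne' (by linarith))
  have hyz : y ≠ z := fun h => hxy (mul_left_cancel₀ hs.ne' (by linarith))
  have h1 := mul_lt_mul_of_pos_left (hH.gibbsEntropy_lt_of_ne hx hz0 hxz) hs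
  have h2 := mul_lt_mul_of_pos_left (hH.gibbsEntropy_lt_of_ne hy hz0 hyz) ht
  -- Both endpoints are compared with the tangent at `z`, and the slopes cancel in the convex
  -- combination.
  have h3 : s * (H.inverseTemperature z * (x - z)) +
      (1 - s) * (H.inverseTemperature z * (y - z)) = 0 := by rw [hz]; ring
  linarith

end Hamiltonian

end GibbsEntropy

end

theorem mainTheorem6 {A : Type*} [NormedAddCommGroup A] [InnerProductSpace ℂ A] [CompleteSpace A]
    (H : GibbsEntropy.Hamiltonian A) (hH : H.GibbsHypothesis) (a : ℝ) (ha : 1 < a) :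
    (∀ E : ℝ, 0 < E → ∃! β : NNReal, H.IsInverseTemperature E β) ∧
    (∀ E : ℝ, 0 ≤ E →
      GibbsEntropy.IsState (H.gibbsState E) ∧
      H.energy (H.gibbsState E) ≤ ENNReal.ofReal E ∧
      GibbsEntropy.entropy a (H.gibbsState E) < ⊤ ∧
      ∀ ρ : A →L[ℂ] A, GibbsEntropy.IsState ρ → H.energy ρ ≤ ENNReal.ofReal E →
        GibbsEntropy.entropy a ρ ≤ GibbsEntropy.entropy a (H.gibbsState E)) ∧
    StrictMonoOn (fun E : ℝ => (GibbsEntropy.entropy a (H.gibbsState E)).toReal) (Set.Ici 0) ∧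
    StrictConcaveOn ℝ (Set.Ici 0)
      (fun E : ℝ => (GibbsEntropy.entropy a (H.gibbsState E)).toReal) := by
  have hlog : 0 < (Real.log a)⁻¹ := inv_pos.2 (Real.log_pos ha)
  -- Changing the base only rescales by the positive constant `1 / log a`, which preserves both
  -- strict properties.
  have hS : Set.EqOn (fun E => (Real.log a)⁻¹ * H.gibbsEntropy E)
      (fun E : ℝ => (GibbsEntropy.entropy a (H.gibbsState E)).toReal) (Set.Ici 0) := fun E hE => by
    simp only [hH.entropy_gibbsState ha hE]
    rw [ENNReal.toReal_ofReal (mul_nonneg hlog.le (hH.gibbsEntropy_nonneg E))]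
  refine ⟨fun E hE => hH.existsUnique_inverseTemperature hE, fun E hE =>
    ⟨hH.isState_gibbsState E, (hH.energy_gibbsState hE).le, ?_,
      fun ρ hρ hρE => hH.entropy_le ha hE hρ hρE⟩, ?_, ?_⟩
  · rw [hH.entropy_gibbsState ha hE]
    exact ENNReal.ofReal_lt_top
  · refine StrictMonoOn.congr (fun x hx y hy h => ?_) hS
    exact mul_lt_mul_of_pos_left (hH.strictMonoOn_gibbsEntropy hx hy h) hlog
  · refine StrictConcaveOn.congr ⟨convex_Ici 0, fun x hx y hy hxy s t hs ht hst => ?_⟩ hS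
    have h := mul_lt_mul_of_pos_left
      (hH.strictConcaveOn_gibbsEntropy.2 hx hy hxy hs ht hst) hlog
    simp only [smul_eq_mul] at h ⊢
    linarith
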